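/- **Theorem.** Let $G=(V,E)$ be a finite simple graph with $n=|V|$ and $m=|E|$. A vertex $u$ ve-dominates every edge of $G$ that is incident to some vertex of the closed neighbourhood $N_G[u]$; a set $S\subseteq V$ is a ve-dominating set if every edge of $G$ is ve-dominated by some vertex of $S$. A block of $G$ is a maximal connected induced subgraph of $G$ that has no cut vertex of its own, where a cut vertex of a graph is a vertex whose removal increases the number of connected components; $G$ is a block graph if each of its blocks is a complete graph ($G$ need not be connected). There is an algorithm that, given the adjacency lists of any block graph $G$ with vertex set $\{0,\dots,n-1\}$ (each list in any order), outputs a ve-dominating set of $G$ of minimum cardinality, together with its cardinality, and runs in $\mathcal{O}(n+m)$ time; that is, there are a single program for a unit-cost random access machine (whose only arithmetic operations are adding and subtracting one) and a constant $C$ such that on each such input the program halts within $C\,(n+m+1)$ steps. -/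

import Mathlib

namespace VEDom

/-! ### ve-domination and block graphs -/

section Graphs

variable {V : Type*}

/-- `u` ve-dominates every edge that is incident to some vertex of the closed neighbourhood
`N[u]`. -/
def VEDominates (G : SimpleGraph V) (u : V) (e : Sym2 V) : Prop :=
  ∃ x ∈ insert u (G.neighborSet u), e ∈ G.incidenceSet x

/-- `S` is a ve-dominating set: every edge is ve-dominated by some vertex of `S`. -/
def IsVEDominatingSet (G : SimpleGraph V) (S : Finset V) : Prop :=
  ∀ e ∈ G.edgeSet, ∃ u ∈ S, VEDominates G u e

/-- A ve-dominating set of minimum cardinality. -/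
def IsMinimumVEDominatingSet (G : SimpleGraph V) (S : Finset V) : Prop :=
  IsVEDominatingSet G S ∧ ∀ T : Finset V, IsVEDominatingSet G T → S.card ≤ T.card

/-- `v` is a cut vertex (of a finite graph): its removal increases the number of connected
components. -/
def IsCutVertex (G : SimpleGraph V) (v : V) : Prop :=
  Nat.card G.ConnectedComponent < Nat.card (G.induce {v}ᶜ).ConnectedComponent

/-- `B` is the vertex set of a block: a maximal connected induced subgraph that has no cut vertex
of its own. -/
def IsBlock (G : SimpleGraph V) (B : Set V) : Prop :=
  Maximal (fun A : Set V =>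
    (G.induce A).Connected ∧ ∀ v : A, ¬ IsCutVertex (G.induce A) v) B

/-- A block graph: every block is complete. Connectedness is not required. -/
def IsBlockGraph (G : SimpleGraph V) : Prop :=
  ∀ B : Set V, IsBlock G B → G.IsClique B

end Graphs

/-! ### A random access machine with a step count

The machine has registers `0, 1, 2, …` and arrays `0, 1, 2, …` of unbounded length, all of whose
entries are natural numbers. A program is a fixed finite text, so it can name only finitely many
registers and arrays; an array is accessed at the index held in a register. The only arithmetic is
adding or subtracting one, so a number held by the machine exceeds the largest input number and the
constants of the program by at most the number of steps made so far. Hence a run of linear length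
handles only numbers of `O(log n)` bits, and charging one unit of time per instruction is
realistic. -/

/-- The memory of the machine. -/
@[ext]
structure State where
  reg : ℕ → ℕ
  arr : ℕ → ℕ → ℕ

/-- Write `k` to register `x`. -/
def State.setReg (s : State) (x k : ℕ) : State :=
  { s with reg := Function.update s.reg x k }

/-- Write `k` to position `i` of array `a`. -/
def State.setArr (s : State) (a i k : ℕ) : State :=
  { s with arr := Function.update s.arr a (Function.update (s.arr a) i k) }

/-- Comparisons of two registers. -/
inductive Test where
  | eq (x y : ℕ)
  | lt (x y : ℕ)

/-- The outcome of a comparison. -/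
def Test.holds : Test → State → Prop
  | .eq x y, s => s.reg x = s.reg y
  | .lt x y, s => s.reg x < s.reg y

/-- Single instructions. -/
inductive Instr where
  /-- `x := k` -/
  | const (x k : ℕ)
  /-- `x := y` -/
  | copy (x y : ℕ)
  /-- `x := x + 1` -/
  | succ (x : ℕ)
  /-- `x := x - 1`, truncated at `0` -/
  | pred (x : ℕ)
  /-- `x := a[y]` -/
  | load (x a y : ℕ)
  /-- `a[y] := x` -/
  | store (a y x : ℕ)

/-- The effect of a single instruction. -/
def Instr.exec : Instr → State → State
  | .const x k, s => s.setReg x k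
  | .copy x y, s => s.setReg x (s.reg y)
  | .succ x, s => s.setReg x (s.reg x + 1)
  | .pred x, s => s.setReg x (s.reg x - 1)
  | .load x a y, s => s.setReg x (s.arr a (s.reg y))
  | .store a y x, s => s.setArr a (s.reg y) (s.reg x)

/-- Programs. -/
inductive Program where
  | skip
  | instr (i : Instr)
  | seq (p q : Program)
  | ifElse (b : Test) (p q : Program)
  | loop (b : Test) (p : Program)

/-- `Run p s t s'`: started in memory `s`, the program `p` halts after exactly `t` steps with
memory `s'`. Every executed instruction and every evaluated test costs one step. -/
inductive Run : Program → State → ℕ → State → Prop where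
  | skip (s : State) : Run .skip s 1 s
  | instr (i : Instr) (s : State) : Run (.instr i) s 1 (i.exec s)
  | seq {p q : Program} {s s' s'' : State} {t t' : ℕ} :
      Run p s t s' → Run q s' t' s'' → Run (.seq p q) s (t + t') s''
  | ifTrue {b : Test} {p q : Program} {s s' : State} {t : ℕ} :
      b.holds s → Run p s t s' → Run (.ifElse b p q) s (t + 1) s'
  | ifFalse {b : Test} {p q : Program} {s s' : State} {t : ℕ} :
      ¬ b.holds s → Run q s t s' → Run (.ifElse b p q) s (t + 1) s'
  | loopDone {b : Test} {p : Program} {s : State} :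
      ¬ b.holds s → Run (.loop b p) s 1 s
  | loopStep {b : Test} {p : Program} {s s' s'' : State} {t t' : ℕ} :
      b.holds s → Run p s t s' → Run (.loop b p) s' t' s'' →
      Run (.loop b p) s (t + t' + 1) s''

/-- The machine is deterministic: running time and result of a halting run are unique. -/
theorem Run.deterministic {p : Program} {s s₁ : State} {t₁ : ℕ} (h₁ : Run p s t₁ s₁) :
    ∀ {t₂ : ℕ} {s₂ : State}, Run p s t₂ s₂ → t₁ = t₂ ∧ s₁ = s₂ := by
  induction h₁ with
  | skip s => intro t₂ s₂ h; cases h; exact ⟨rfl, rfl⟩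
  | instr i s => intro t₂ s₂ h; cases h; exact ⟨rfl, rfl⟩
  | seq _ _ ih₁ ih₂ =>
    intro t₂ s₂ h
    cases h with
    | seq a b =>
      obtain ⟨rfl, rfl⟩ := ih₁ a
      obtain ⟨rfl, rfl⟩ := ih₂ b
      exact ⟨rfl, rfl⟩
  | ifTrue hb _ ih =>
    intro t₂ s₂ h
    cases h with
    | ifTrue _ a => obtain ⟨rfl, rfl⟩ := ih a; exact ⟨rfl, rfl⟩
    | ifFalse hb' _ => exact absurd hb hb'
  | ifFalse hb _ ih =>
    intro t₂ s₂ h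
    cases h with
    | ifTrue hb' _ => exact absurd hb' hb
    | ifFalse _ a => obtain ⟨rfl, rfl⟩ := ih a; exact ⟨rfl, rfl⟩
  | loopDone hb =>
    intro t₂ s₂ h
    cases h with
    | loopDone _ => exact ⟨rfl, rfl⟩
    | loopStep hb' _ _ => exact absurd hb' hb
  | loopStep hb _ _ ih₁ ih₂ =>
    intro t₂ s₂ h
    cases h with
    | loopDone hb' => exact absurd hb hb'
    | loopStep _ a b =>
      obtain ⟨rfl, rfl⟩ := ih₁ a
      obtain ⟨rfl, rfl⟩ := ih₂ b
      exact ⟨rfl, rfl⟩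

/-! ### Input and output -/

/-- `adj` gives adjacency lists of `G`: the list of `v` names every neighbour of `v` exactly once,
in any order. -/
def IsAdjacencyList {n : ℕ} (G : SimpleGraph (Fin n)) (adj : Fin n → List (Fin n)) : Prop :=
  ∀ v, (adj v).Nodup ∧ ∀ u, u ∈ adj v ↔ G.Adj v u

/-- The initial memory. Register `0` holds the number `n` of vertices. Array `1` holds the
adjacency lists of the vertices `0, …, n - 1`, one after the other; array `0` holds their bounds:
the list of vertex `v` occupies the positions `i` of array `1` with
`arr 0 v ≤ i < arr 0 (v + 1)`. Everything else is `0`. -/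
def inputState {n : ℕ} (adj : Fin n → List (Fin n)) : State where
  reg x := if x = 0 then n else 0
  arr a i :=
    if a = 0 then ((List.ofFn adj).take i).flatten.length
    else if a = 1 then (((List.ofFn adj).flatten.map Fin.val)[i]?).getD 0
    else 0

/-- The final memory `s` lists the set `S` without repetition: register `1` holds its cardinality
`k`, and the first `k` entries of array `2` are its elements. -/
def Outputs {n : ℕ} (s : State) (S : Finset (Fin n)) : Prop :=
  s.reg 1 = S.card ∧ ∀ v : Fin n, v ∈ S ↔ ∃ i < s.reg 1, s.arr 2 i = (v : ℕ)

end VEDom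

namespace VEDom

/-! ### Walks around a vertex of a block graph -/

section BlockGraphs

variable {V : Type*} {G : SimpleGraph V}

/-! A greedy selection along a breadth-first order is optimal because it comes with a packing of
edges of the same size. In a block graph, two neighbours of a vertex that are joined by a walk
avoiding it lie on a common cycle, hence in a common block, so they are equal or adjacent
(`IsBlockGraph.eq_or_adj_of_walk`). It follows that every edge joins a vertex to its breadth-first
parent or joins two vertices with the same parent (`IsBreadthFirst.adj_cases`). The vertices are
treated in reverse breadth-first order. If some edge `vx` with `x ≠ p v` has both ends outside the
closed neighbourhood of the selection, then `p v` is selected and `vx` is recorded. By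
`IsBreadthFirst.parent_mem_edgeNbhd`, a common dominator of a recorded edge and a later treated one
would make the vertex selected for the former dominate the latter, which then would not be recorded.
So the recorded edges have pairwise disjoint sets of dominators; every ve-dominating set has at
least as many vertices as there are recorded edges, and the selection has no more. For the running
time, each adjacency list is scanned a bounded number of times: once in the search, at most once
when its vertex is treated, at most once when its vertex is selected. The sum of the list lengths is
`2m`. -/

theorem reachable_induce_of_walk {A : Set V} {a b : V} (q : G.Walk a b)
    (hq : ∀ x ∈ q.support, x ∈ A) (ha : a ∈ A) (hb : b ∈ A) :
    (G.induce A).Reachable ⟨a, ha⟩ ⟨b, hb⟩ :=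
  ⟨q.induce A hq⟩

theorem reachable_induce_induce_of_walk {A : Set V} {c : A} {a b : V} (q : G.Walk a b)
    (hq : ∀ x ∈ q.support, x ∈ A) (hc : ∀ x ∈ q.support, x ≠ c) (ha : a ∈ A) (hb : b ∈ A)
    (hac : (⟨a, ha⟩ : A) ∈ ({c}ᶜ : Set A)) (hbc : (⟨b, hb⟩ : A) ∈ ({c}ᶜ : Set A)) :
    ((G.induce A).induce {c}ᶜ).Reachable ⟨⟨a, ha⟩, hac⟩ ⟨⟨b, hb⟩, hbc⟩ := by
  refine reachable_induce_of_walk (q.induce A hq) ?_ hac hbc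
  intro x hx
  have hx' : (x : V) ∈ ((q.induce A hq).map (SimpleGraph.Embedding.induce A).toHom).support := by
    rw [SimpleGraph.Walk.support_map]
    exact List.mem_map.2 ⟨x, hx, rfl⟩
  rw [SimpleGraph.Walk.map_induce] at hx'
  intro h
  exact hc _ hx' (congrArg Subtype.val h)

/-- A vertex set that remains connected after the removal of any one vertex is a clique of a
block graph. -/
theorem IsBlockGraph.isClique_of_preconnected [Finite V] (hG : IsBlockGraph G) {A : Set V}
    (hA : (G.induce A).Connected)
    (hcut : ∀ c : A, ((G.induce A).induce {c}ᶜ).Preconnected) : G.IsClique A := by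
  -- `A` has at least one component, and deleting a vertex leaves at most one (possibly none), so
  -- `A` has no cut vertex and extends to a block.
  obtain ⟨B, hAB, hB⟩ := Finite.exists_le_maximal
    (p := fun A : Set V => (G.induce A).Connected ∧ ∀ v : A, ¬ IsCutVertex (G.induce A) v)
    (a := A) ⟨hA, fun c => by
      have h1 := (hcut c).subsingleton_connectedComponent
      have h2 : Nat.card ((G.induce A).induce {c}ᶜ).ConnectedComponent ≤ 1 :=
        Finite.card_le_one_iff_subsingleton.2 h1
      have h3 : 0 < Nat.card (G.induce A).ConnectedComponent := by
        have : Nonempty (G.induce A).ConnectedComponent :=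
          ⟨(G.induce A).connectedComponentMk c⟩
        exact Nat.card_pos
      unfold IsCutVertex
      omega⟩
  exact (hG B hB).subset hAB

/-- A path meets `c` at most once, hence not on both sides of `x`; the half that misses `c` leads to
an end. -/
theorem exists_walk_avoiding_of_isPath {a b x c : V} {q : G.Walk a b} (hq : q.IsPath)
    (hx : x ∈ q.support) (hxc : x ≠ c) :
    (∃ r : G.Walk x a, (∀ y ∈ r.support, y ∈ q.support) ∧ c ∉ r.support) ∨
      ∃ r : G.Walk x b, (∀ y ∈ r.support, y ∈ q.support) ∧ c ∉ r.support := by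
  classical
  by_cases h : c ∈ (q.takeUntil x hx).support
  · refine Or.inr ⟨q.dropUntil x hx, fun y hy => q.support_dropUntil_subset_support hx hy, ?_⟩
    intro hc
    have hnd := hq.support_nodup
    rw [← q.take_spec hx, SimpleGraph.Walk.support_append] at hnd
    rw [SimpleGraph.Walk.mem_support_iff] at hc
    rcases hc with rfl | hc
    · exact hxc rfl
    · exact (List.nodup_append.1 hnd).2.2 _ h _ hc rfl
  · refine Or.inl ⟨(q.takeUntil x hx).reverse, fun y hy => ?_, by simpa using h⟩
    exact q.support_takeUntil_subset_support hx (by simpa using hy)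

/-- Two neighbours of `v` that are joined by a walk avoiding `v` are equal or adjacent. -/
theorem IsBlockGraph.eq_or_adj_of_walk [Finite V] (hG : IsBlockGraph G) {v a b : V}
    (ha : G.Adj v a) (hb : G.Adj v b) (q : G.Walk a b) (hv : v ∉ q.support) :
    a = b ∨ G.Adj a b := by
  classical
  let r := q.bypass
  have hr : r.IsPath := q.bypass_isPath
  have hvr : v ∉ r.support := fun h => hv (q.support_bypass_subset_support h)
  -- A path from `a` to `b` closed up through `v`: a cycle, possibly degenerate, which no single
  -- deletion disconnects.
  let A : Set V := insert v {x | x ∈ r.support}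
  have hvA : v ∈ A := Set.mem_insert _ _
  have hrA : ∀ x ∈ r.support, x ∈ A := fun x hx => Set.mem_insert_of_mem _ hx
  have haA : a ∈ A := hrA _ r.start_mem_support
  have hbA : b ∈ A := hrA _ r.end_mem_support
  have hA : (G.induce A).Connected := by
    have : Nonempty A := ⟨⟨v, hvA⟩⟩
    refine ⟨fun x y => ?_⟩
    have key : ∀ x : A, (G.induce A).Reachable x ⟨a, haA⟩ := by
      rintro ⟨x, rfl | hx⟩
      · exact SimpleGraph.Adj.reachable (by simpa using ha)
      · exact reachable_induce_of_walk (r.takeUntil x hx).reverse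
          (fun y hy => hrA _ (r.support_takeUntil_subset_support hx (by simpa using hy))) _ _
    exact (key x).trans (key y).symm
  have hclique : G.IsClique A := by
    refine hG.isClique_of_preconnected hA fun c => ?_
    by_cases hcv : (c : V) = v
    · have hac : (⟨a, haA⟩ : A) ∈ ({c}ᶜ : Set A) := by
        intro h
        exact ha.ne (hcv.symm.trans (congrArg Subtype.val h).symm)
      have key : ∀ x : ({c}ᶜ : Set A),
          ((G.induce A).induce {c}ᶜ).Reachable x ⟨⟨a, haA⟩, hac⟩ := by
        rintro ⟨⟨x, rfl | hx⟩, hxc⟩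
        · exact absurd (Subtype.ext hcv.symm) hxc
        · refine reachable_induce_induce_of_walk (r.takeUntil x hx).reverse ?_ ?_ _ _ _ _
          · exact fun y hy =>
              hrA _ (r.support_takeUntil_subset_support hx (by simpa using hy))
          · rintro y hy rfl
            apply hvr
            rw [← hcv]
            exact r.support_takeUntil_subset_support hx (by simpa using hy)
      exact fun x y => (key x).trans (key y).symm
    · have hvc : (⟨v, hvA⟩ : A) ∈ ({c}ᶜ : Set A) := by
        intro h
        exact hcv (congrArg Subtype.val h).symm
      have key : ∀ x : ({c}ᶜ : Set A),
          ((G.induce A).induce {c}ᶜ).Reachable x ⟨⟨v, hvA⟩, hvc⟩ := by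
        rintro ⟨⟨x, rfl | hx⟩, hxc⟩
        · exact SimpleGraph.Reachable.refl _
        -- With `c` deleted from the path, `x` still reaches `a` or `b` along the path, and from
        -- there `v`.
        · have hne : x ≠ c := fun h => hxc (Subtype.ext h)
          have lift : ∀ {d : V} (w : G.Walk x d), (∀ y ∈ w.support, y ∈ r.support) →
              (c : V) ∉ w.support → G.Adj d v →
              ((G.induce A).induce {c}ᶜ).Reachable ⟨⟨x, Or.inr hx⟩, hxc⟩ ⟨⟨v, hvA⟩, hvc⟩ := by
            intro d w hw hcw hd
            refine reachable_induce_induce_of_walk (w.concat hd) ?_ ?_ _ _ _ _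
            · intro y hy
              rw [SimpleGraph.Walk.support_concat] at hy
              simp only [List.mem_append, List.mem_singleton] at hy
              rcases hy with hy | rfl
              · exact hrA _ (hw _ hy)
              · exact hvA
            · intro y hy
              rw [SimpleGraph.Walk.support_concat] at hy
              simp only [List.mem_append, List.mem_singleton] at hy
              rcases hy with hy | rfl
              · rintro rfl
                exact hcw hy
              · exact fun h => hcv h.symm
          rcases exists_walk_avoiding_of_isPath hr hx hne with ⟨w, hw, hcw⟩ | ⟨w, hw, hcw⟩
          · exact lift w hw hcw ha.symm
          · exact lift w hw hcw hb.symm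
      exact fun x y => (key x).trans (key y).symm
  by_cases hab : a = b
  · exact Or.inl hab
  · exact Or.inr (hclique haA hbA hab)

end BlockGraphs

/-! ### Breadth-first orders -/

/-- `pos` enumerates the vertices in the order of a breadth-first search with parent function `p`;
the starting vertices of the search are their own parents. -/
structure IsBreadthFirst {V : Type*} (G : SimpleGraph V) (pos : V → ℕ) (p : V → V) : Prop where
  injective : Function.Injective pos
  parent_le : ∀ v, pos (p v) ≤ pos v
  parent_mono : ∀ u v, pos u ≤ pos v → pos (p u) ≤ pos (p v)
  parent_adj : ∀ v, p v = v ∨ G.Adj (p v) v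
  parent_min : ∀ u v, G.Adj u v → pos (p v) ≤ pos u

section Greedy

variable {V : Type*} {G : SimpleGraph V} {pos : V → ℕ} {p : V → V}

/-- By `parent_mono` the pair `(p b, a)` satisfies the same two bounds with a smaller sum; reversing
its walk and adding the edge from `p b` to `b` finishes. The position bound lets the walk avoid any
later vertex. -/
theorem IsBreadthFirst.exists_walk (h : IsBreadthFirst G pos p) (a b : V)
    (hba : pos (p b) ≤ pos a) (hab : pos a ≤ pos b) :
    ∃ q : G.Walk a b, ∀ x ∈ q.support, pos x ≤ pos b := by
  induction hk : pos a + pos b using Nat.strong_induction_on generalizing a b with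
  | _ k ih =>
    rcases h.parent_adj b with hb | hb
    · rw [hb] at hba
      obtain rfl := h.injective (le_antisymm hab hba)
      exact ⟨.nil, by simp⟩
    · have hlt : pos (p b) < pos b :=
        lt_of_le_of_ne (h.parent_le b) fun e => hb.ne (h.injective e)
      obtain ⟨q, hq⟩ := ih (pos (p b) + pos a) (by omega) (p b) a (h.parent_mono _ _ hab) hba rfl
      refine ⟨q.reverse.concat hb, fun x hx => ?_⟩
      rw [SimpleGraph.Walk.support_concat] at hx
      simp only [List.mem_append, List.mem_singleton,
        SimpleGraph.Walk.support_reverse, List.mem_reverse] at hx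
      rcases hx with hx | rfl
      · exact (hq _ hx).trans hab
      · exact le_rfl

/-- Otherwise `p v` precedes `u`, and a walk among early vertices avoids `v`, so `p v` and `u` are
adjacent. In the same way, around `u`, `p u` strictly precedes `p v` and is adjacent to it. Around
`p v`, the walk `v, u, p u` then makes `v` equal or adjacent to `p u`, a neighbour too early for
`parent_min`. -/
theorem IsBreadthFirst.eq_parent_or_parent_eq [Finite V] (h : IsBreadthFirst G pos p)
    (hG : IsBlockGraph G) {u v : V} (huv : G.Adj u v) (hlt : pos u < pos v) :
    u = p v ∨ p u = p v := by
  by_contra! hne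
  obtain ⟨h1, h2⟩ := hne
  have hpv : pos (p v) < pos u :=
    lt_of_le_of_ne (h.parent_min _ _ huv) fun e => h1 (h.injective e).symm
  have hvp : G.Adj v (p v) := by
    rcases h.parent_adj v with e | e
    · rw [e] at hpv; omega
    · exact e.symm
  obtain ⟨q, hq⟩ := h.exists_walk (p v) u (h.parent_mono _ _ hlt.le) hpv.le
  have hadj : G.Adj (p v) u := by
    rcases hG.eq_or_adj_of_walk hvp huv.symm q (fun hm => by have := hq _ hm; omega) with e | e
    · exact absurd e.symm h1
    · exact e
  have hpu : pos (p u) < pos (p v) :=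
    lt_of_le_of_ne (h.parent_min _ _ hadj) fun e => h2 (h.injective e)
  have hup : G.Adj u (p u) := by
    rcases h.parent_adj u with e | e
    · rw [e] at hpu; omega
    · exact e.symm
  obtain ⟨q, hq⟩ := h.exists_walk (p u) (p v) (h.parent_mono _ _ hpv.le) hpu.le
  have hpp : G.Adj (p u) (p v) := by
    rcases hG.eq_or_adj_of_walk hup hadj.symm q (fun hm => by have := hq _ hm; omega) with e | e
    · exact absurd e h2
    · exact e
  have hmem : p v ∉ (SimpleGraph.Walk.cons huv.symm (.cons hup .nil)).support := by
    simp only [SimpleGraph.Walk.support_cons, SimpleGraph.Walk.support_nil, List.mem_cons,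
      List.not_mem_nil, or_false, not_or]
    exact ⟨hvp.ne', fun e => h1 e.symm, fun e => h2 e.symm⟩
  rcases hG.eq_or_adj_of_walk hvp.symm hpp.symm _ hmem with e | e
  · rw [← e] at hpu; omega
  · have := h.parent_min _ _ e.symm
    omega

theorem IsBreadthFirst.adj_cases [Finite V] (h : IsBreadthFirst G pos p)
    (hG : IsBlockGraph G) {u v : V} (huv : G.Adj u v) : u = p v ∨ v = p u ∨ p u = p v := by
  rcases lt_trichotomy (pos u) (pos v) with hlt | he | hlt
  · rcases h.eq_parent_or_parent_eq hG huv hlt with e | e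
    · exact Or.inl e
    · exact Or.inr (Or.inr e)
  · exact absurd (h.injective he) huv.ne
  · rcases h.eq_parent_or_parent_eq hG huv.symm hlt with e | e
    · exact Or.inr (Or.inl e)
    · exact Or.inr (Or.inr e.symm)

/-! ### Common dominators of two edges -/

/-- The vertices that ve-dominate the edge `vx`. -/
def EdgeNbhd (G : SimpleGraph V) (v x : V) : Set V :=
  {w | (w = v ∨ G.Adj v w) ∨ (w = x ∨ G.Adj x w)}

theorem mem_edgeNbhd_iff_veDominates {v x w : V} (hvx : G.Adj v x) :
    w ∈ EdgeNbhd G v x ↔ VEDominates G w s(v, x) := by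
  simp only [EdgeNbhd, VEDominates, Set.mem_ofPred_eq, Set.mem_insert_iff,
    SimpleGraph.mem_neighborSet, SimpleGraph.incidenceSet, SimpleGraph.mem_edgeSet, Sym2.mem_iff]
  constructor
  · rintro ((rfl | h) | (rfl | h))
    · exact ⟨w, Or.inl rfl, hvx, Or.inl rfl⟩
    · exact ⟨v, Or.inr h.symm, hvx, Or.inl rfl⟩
    · exact ⟨w, Or.inl rfl, hvx, Or.inr rfl⟩
    · exact ⟨x, Or.inr h.symm, hvx, Or.inr rfl⟩
  · rintro ⟨y, rfl | h, -, rfl | rfl⟩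
    · exact Or.inl (Or.inl rfl)
    · exact Or.inr (Or.inl rfl)
    · exact Or.inl (Or.inr h.symm)
    · exact Or.inr (Or.inr h.symm)

/-- As `x` is a child or a sibling of `v`, `adj_cases` locates all dominators of `vx` by their
parents, apart from `p v` itself. Comparing two edges thus becomes comparing parents. -/
theorem IsBreadthFirst.parent_cases_of_mem_edgeNbhd [Finite V] (h : IsBreadthFirst G pos p)
    (hG : IsBlockGraph G) {v x w : V} (hx : p x = v ∨ p x = p v) (hw : w ∈ EdgeNbhd G v x) :
    w = p v ∨ p w = v ∨ p w = p v ∨ p w = x := by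
  rcases hw with (rfl | e) | (rfl | e)
  · simp
  · rcases h.adj_cases hG e with e | e | e
    · simp [← e]
    · simp [← e]
    · simp [e]
  · rcases hx with e | e <;> simp [e]
  · rcases h.adj_cases hG e with e | e | e
    · simp [← e]
    · rcases hx with e' | e' <;> simp [e, e']
    · rcases hx with e' | e' <;> simp [← e, e']

/-- If two edges have a common dominating vertex, then the parent of the end of the earlier
treated one dominates the later treated one. -/
theorem IsBreadthFirst.parent_mem_edgeNbhd [Finite V] (h : IsBreadthFirst G pos p)
    (hG : IsBlockGraph G) {v x v' x' w : V} (hvx : G.Adj v x) (hx : x ≠ p v)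
    (hvx' : G.Adj v' x') (hx' : x' ≠ p v') (hle : pos v' ≤ pos v)
    (hw : w ∈ EdgeNbhd G v x) (hw' : w ∈ EdgeNbhd G v' x') : p v ∈ EdgeNbhd G v' x' := by
  -- The parent of either end of `v'x'` dominates that edge; for a root the parent is the end
  -- itself.
  have par : ∀ u, p u ∈ EdgeNbhd G v' x' ∨ (u ≠ v' ∧ u ≠ x') := by
    intro u
    by_cases h1 : u = v'
    · subst h1
      exact Or.inl (Or.inl ((h.parent_adj u).imp id fun e => e.symm))
    by_cases h2 : u = x'
    · subst h2
      exact Or.inl (Or.inr ((h.parent_adj u).imp id fun e => e.symm))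
    exact Or.inr ⟨h1, h2⟩
  have hv' : p v' ∈ EdgeNbhd G v' x' := (par v').resolve_right fun e => e.1 rfl
  have hxp' : p x' ∈ EdgeNbhd G v' x' := (par x').resolve_right fun e => e.2 rfl
  have hvm : v' ∈ EdgeNbhd G v' x' := Or.inl (Or.inl rfl)
  have hxm : x' ∈ EdgeNbhd G v' x' := Or.inr (Or.inl rfl)
  have hc : p x = v ∨ p x = p v := by
    rcases h.adj_cases hG hvx with e | e | e
    · exact Or.inl e.symm
    · exact absurd e hx
    · exact Or.inr e.symm
  have hc' : p x' = v' ∨ p x' = p v' := by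
    rcases h.adj_cases hG hvx' with e | e | e
    · exact Or.inl e.symm
    · exact absurd e hx'
    · exact Or.inr e.symm
  have eq_of : ∀ {a b : V}, pos a ≤ pos b → pos b ≤ pos a → a = b :=
    fun h1 h2 => h.injective (le_antisymm h1 h2)
  have hpp := h.parent_mono _ _ hle
  have lev := h.parent_le v
  have lev' := h.parent_le v'
  have lew := h.parent_le w
  have lex := h.parent_le x
  -- Cases on the place of `w` below `vx`, then below `v'x'`. Each one identifies `p v` with an end
  -- of `v'x'` or with the parent of an end, or is impossible by position.
  rcases h.parent_cases_of_mem_edgeNbhd hG hc hw with e | e | e | e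
  · exact e ▸ hw'
  · rcases h.parent_cases_of_mem_edgeNbhd hG hc' hw' with f | f | f | f
    · have : v = v' := eq_of (by rw [e, f] at lew; omega) hle
      exact this ▸ hv'
    · rw [← e, f]; exact hv'
    · have : v = v' := eq_of (by rw [← e, f]; exact lev') hle
      exact this ▸ hv'
    · rw [← e, f]; exact hxp'
  · rcases h.parent_cases_of_mem_edgeNbhd hG hc' hw' with f | f | f | f
    · have : pos (p v) ≤ pos (p v') := by
        have := h.parent_mono w v' (by rw [f]; exact lev')
        rwa [e] at this
      rw [eq_of this hpp]; exact hv'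
    · rw [← e, f]; exact hvm
    · rw [← e, f]; exact hv'
    · rw [← e, f]; exact hxm
  · have hxv : pos x ≤ pos v → p x = p v := by
      intro hle'
      rcases hc with c | c
      · exact absurd (eq_of hle' (by rw [← c]; exact lex)) hvx.ne'
      · exact c
    -- So early an `x` is a sibling of `v`, and `p v = p x` is not after `x`, which is not after `p
    -- v`. This forces the excluded `x = p v`.
    have hcontra : pos x ≤ pos (p v') → False := by
      intro hle'
      have hxe := hxv (by omega)
      refine hx (eq_of (by omega) ?_)
      rw [← hxe]; exact lex
    rcases h.parent_cases_of_mem_edgeNbhd hG hc' hw' with f | f | f | f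
    · exact (hcontra (by rw [← f, ← e]; exact lew)).elim
    · have hxe : x = v' := e.symm.trans f
      rw [← hxv (by rw [hxe]; exact hle), hxe]; exact hv'
    · exact (hcontra (by rw [← e, f])).elim
    · have hxe : x = x' := e.symm.trans f
      rcases hc with c | c
      · rw [hxe] at c
        have : v = v' := by
          rcases hc' with c' | c'
          · rw [← c, c']
          · exact eq_of (by rw [← c, c']; exact lev') hle
        exact this ▸ hv'
      · rw [← c, hxe]; exact hxp'

/-! ### The greedy invariant and optimality -/

/-- `v` lies in the closed neighbourhood of `S`. -/
def Covered (G : SimpleGraph V) (S : Finset V) (v : V) : Prop :=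
  ∃ s ∈ S, s = v ∨ G.Adj s v

theorem covered_insert [DecidableEq V] {S : Finset V} {s v : V} :
    Covered G (insert s S) v ↔ (s = v ∨ G.Adj s v) ∨ Covered G S v := by
  simp [Covered]

/-- The state of the greedy algorithm when exactly the vertices `v` with `k ≤ pos v` have been
treated: `S` has been selected, and `F` consists of edges no two of which are dominated by one
vertex. -/
structure GreedyInvariant (G : SimpleGraph V) (pos : V → ℕ) (p : V → V) (k : ℕ)
    (S : Finset V) (F : Finset (V × V)) : Prop where
  card_le : S.card ≤ F.card
  adj : ∀ e ∈ F, G.Adj e.1 e.2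
  ne_parent : ∀ e ∈ F, e.2 ≠ p e.1
  le_pos : ∀ e ∈ F, k ≤ pos e.1
  parent_mem : ∀ e ∈ F, p e.1 ∈ S
  disjoint : ∀ e ∈ F, ∀ f ∈ F, e ≠ f → Disjoint (EdgeNbhd G e.1 e.2) (EdgeNbhd G f.1 f.2)
  covered : ∀ v x, G.Adj v x → x ≠ p v → k ≤ pos v → Covered G S v ∨ Covered G S x

theorem GreedyInvariant.step_of_covered {k : ℕ} {S : Finset V} {F : Finset (V × V)} {v : V}
    (h : IsBreadthFirst G pos p) (hI : GreedyInvariant G pos p (k + 1) S F) (hv : pos v = k)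
    (hcov : ∀ x, G.Adj v x → x ≠ p v → Covered G S v ∨ Covered G S x) :
    GreedyInvariant G pos p k S F where
  card_le := hI.card_le
  adj := hI.adj
  ne_parent := hI.ne_parent
  le_pos e he := (Nat.le_succ k).trans (hI.le_pos e he)
  parent_mem := hI.parent_mem
  disjoint := hI.disjoint
  covered u x hux hx hk := by
    rcases hk.eq_or_lt with hk | hk
    · obtain rfl : v = u := h.injective (hv.trans hk)
      exact hcov x hux hx
    · exact hI.covered u x hux hx hk

/-- A dominator shared with a recorded edge `e` would, by `parent_mem_edgeNbhd`, put `p e.1 ∈ S`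
next to or onto `v` or `x`, contrary to both being uncovered. That `p v` is new matters twice: for
the output without repetition and for charging its scan only once. -/
theorem GreedyInvariant.step_of_not_covered [Finite V] [DecidableEq V] {k : ℕ} {S : Finset V}
    {F : Finset (V × V)} {v x : V} (h : IsBreadthFirst G pos p) (hG : IsBlockGraph G)
    (hI : GreedyInvariant G pos p (k + 1) S F) (hv : pos v = k) (hvx : G.Adj v x) (hx : x ≠ p v)
    (hcv : ¬ Covered G S v) (hcx : ¬ Covered G S x) :
    p v ∉ S ∧ GreedyInvariant G pos p k (insert (p v) S) (insert (v, x) F) := by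
  have hpv : p v = v ∨ G.Adj (p v) v := h.parent_adj v
  have hpS : p v ∉ S := fun hm => hcv ⟨p v, hm, hpv⟩
  have hF : (v, x) ∉ F := fun hm => by
    have := hI.le_pos _ hm
    simp only at this
    omega
  have hdisj : ∀ e ∈ F, Disjoint (EdgeNbhd G e.1 e.2) (EdgeNbhd G v x) := by
    intro e he
    rw [Set.disjoint_left]
    intro w hw hw'
    have hm := h.parent_mem_edgeNbhd hG (hI.adj e he) (hI.ne_parent e he) hvx hx
      (by have := hI.le_pos e he; omega) hw hw'
    rcases hm with hm | hm
    · exact hcv ⟨_, hI.parent_mem e he, hm.imp id fun a => a.symm⟩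
    · exact hcx ⟨_, hI.parent_mem e he, hm.imp id fun a => a.symm⟩
  refine ⟨hpS, ?_, ?_, ?_, ?_, ?_, ?_, ?_⟩
  · rw [Finset.card_insert_of_notMem hpS, Finset.card_insert_of_notMem hF]
    exact Nat.succ_le_succ hI.card_le
  · intro e he
    rcases Finset.mem_insert.1 he with rfl | he
    · exact hvx
    · exact hI.adj e he
  · intro e he
    rcases Finset.mem_insert.1 he with rfl | he
    · exact hx
    · exact hI.ne_parent e he
  · intro e he
    rcases Finset.mem_insert.1 he with rfl | he
    · exact hv.ge
    · exact (Nat.le_succ k).trans (hI.le_pos e he)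
  · intro e he
    rcases Finset.mem_insert.1 he with rfl | he
    · exact Finset.mem_insert_self _ _
    · exact Finset.mem_insert_of_mem (hI.parent_mem e he)
  · intro e he f hf hef
    rcases Finset.mem_insert.1 he with rfl | he <;> rcases Finset.mem_insert.1 hf with rfl | hf
    · exact absurd rfl hef
    · exact (hdisj f hf).symm
    · exact hdisj e he
    · exact hI.disjoint e he f hf hef
  · intro u y huy hy hk
    rcases hk.eq_or_lt with hk | hk
    · obtain rfl : v = u := h.injective (hv.trans hk)
      exact Or.inl (covered_insert.2 (Or.inl hpv))
    · exact (hI.covered u y huy hy hk).imp (fun c => covered_insert.2 (Or.inr c))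
        (fun c => covered_insert.2 (Or.inr c))

/-- Choosing for each edge of `F` a dominator in a competing set `T` is injective by disjointness,
so `S.card ≤ F.card ≤ T.card`. -/
theorem GreedyInvariant.isMinimumVEDominatingSet {S : Finset V} {F : Finset (V × V)}
    (h : IsBreadthFirst G pos p) (hI : GreedyInvariant G pos p 0 S F) :
    IsMinimumVEDominatingSet G S := by
  constructor
  · have dom : ∀ v x, G.Adj v x → x ≠ p v → ∃ u ∈ S, VEDominates G u s(v, x) := by
      intro v x hvx hx
      rcases hI.covered v x hvx hx (Nat.zero_le _) with ⟨s, hs, hc⟩ | ⟨s, hs, hc⟩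
      · exact ⟨s, hs, (mem_edgeNbhd_iff_veDominates hvx).1
          (Or.inl (hc.imp id fun a => a.symm))⟩
      · exact ⟨s, hs, (mem_edgeNbhd_iff_veDominates hvx).1
          (Or.inr (hc.imp id fun a => a.symm))⟩
    intro e
    induction e using Sym2.ind with
    | _ v x =>
      intro hvx
      rw [SimpleGraph.mem_edgeSet] at hvx
      by_cases hx : x = p v
      -- The edge is read in the other direction: two distinct vertices cannot be parents of each
      -- other.
      · rw [Sym2.eq_swap]
        refine dom x v hvx.symm fun hv => hvx.ne (h.injective (le_antisymm ?_ ?_))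
        · conv_lhs => rw [hv]
          exact h.parent_le x
        · conv_lhs => rw [hx]
          exact h.parent_le v
      · exact dom v x hvx hx
  · intro T hT
    have hex : ∀ e : V × V, ∃ u, e ∈ F → u ∈ T ∧ u ∈ EdgeNbhd G e.1 e.2 := by
      intro e
      by_cases he : e ∈ F
      · obtain ⟨u, hu, hd⟩ := hT s(e.1, e.2) (hI.adj e he)
        exact ⟨u, fun _ => ⟨hu, (mem_edgeNbhd_iff_veDominates (hI.adj e he)).2 hd⟩⟩
      · exact ⟨e.1, fun h => absurd h he⟩
    choose g hg using hex
    refine hI.card_le.trans (Finset.card_le_card_of_injOn g (fun e he => (hg e he).1) ?_)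
    intro e he f hf hef
    by_contra hne
    exact Set.disjoint_left.1 (hI.disjoint e he f hf hne) (hg e he).2 (hef ▸ (hg f hf).2)

end Greedy

/-! ### Reasoning about runs -/

/-- Started in `s`, the program halts, with a running time and a final memory that satisfy `Q`. -/
def HaltsWith (p : Program) (s : State) (Q : ℕ → State → Prop) : Prop :=
  ∃ t s', Run p s t s' ∧ Q t s'

theorem HaltsWith.mono {p : Program} {s : State} {Q Q' : ℕ → State → Prop}
    (h : HaltsWith p s Q) (hQ : ∀ t s', Q t s' → Q' t s') : HaltsWith p s Q' :=
  let ⟨t, s', hr, hq⟩ := h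
  ⟨t, s', hr, hQ t s' hq⟩

theorem HaltsWith.skip {s : State} {Q : ℕ → State → Prop} (h : Q 1 s) :
    HaltsWith .skip s Q :=
  ⟨1, s, .skip s, h⟩

theorem HaltsWith.instr {i : Instr} {s : State} {Q : ℕ → State → Prop} (h : Q 1 (i.exec s)) :
    HaltsWith (.instr i) s Q :=
  ⟨1, _, .instr i s, h⟩

theorem HaltsWith.seq {p q : Program} {s : State} {Q : ℕ → State → Prop}
    (h : HaltsWith p s fun t s' => HaltsWith q s' fun t' s'' => Q (t + t') s'') :
    HaltsWith (.seq p q) s Q :=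
  let ⟨t, _, hp, t', s'', hq, h⟩ := h
  ⟨t + t', s'', .seq hp hq, h⟩

theorem HaltsWith.ifElse {b : Test} {p q : Program} {s : State} {Q : ℕ → State → Prop}
    (hp : b.holds s → HaltsWith p s fun t s' => Q (t + 1) s')
    (hq : ¬ b.holds s → HaltsWith q s fun t s' => Q (t + 1) s') :
    HaltsWith (.ifElse b p q) s Q := by
  by_cases hb : b.holds s
  · obtain ⟨t, s', hr, h⟩ := hp hb
    exact ⟨t + 1, s', .ifTrue hb hr, h⟩
  · obtain ⟨t, s', hr, h⟩ := hq hb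
    exact ⟨t + 1, s', .ifFalse hb hr, h⟩

/-- A loop with an invariant `I` that also speaks about the time spent so far; a bound on this
time guarantees termination. -/
theorem HaltsWith.loop {b : Test} {p : Program} {s : State} (I : ℕ → State → Prop) (B : ℕ)
    (h0 : I 0 s) (hB : ∀ t s', I t s' → t ≤ B)
    (hstep : ∀ t s', I t s' → b.holds s' → HaltsWith p s' fun t' s'' => I (t + t' + 1) s'') :
    HaltsWith (.loop b p) s fun t s' => ∃ t', t = t' + 1 ∧ I t' s' ∧ ¬ b.holds s' := by
  -- Induction on the remaining time budget, for a loop entered after `t` steps.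
  suffices H : ∀ k t s, I t s → B + 1 - t = k →
      HaltsWith (.loop b p) s fun t' s' => ∃ t'', t + t' = t'' + 1 ∧ I t'' s' ∧ ¬ b.holds s' by
    simpa using H _ 0 s h0 rfl
  intro k
  induction k using Nat.strong_induction_on with
  | _ k ih =>
    intro t s hI hk
    have := hB _ _ hI
    by_cases hb : b.holds s
    · obtain ⟨t₁, s₁, hr₁, hI₁⟩ := hstep t s hI hb
      obtain ⟨t₂, s₂, hr₂, t', ht', hI₂⟩ :=
        ih (B + 1 - (t + t₁ + 1)) (by omega) _ s₁ hI₁ rfl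
      exact ⟨t₁ + t₂ + 1, s₂, .loopStep hb hr₁ hr₂, t', by omega, hI₂⟩
    · exact ⟨1, s, .loopDone hb, t, rfl, hI, hb⟩

/-- A list of instructions as a program. -/
def Program.block : List Instr → Program
  | [] => .skip
  | i :: l => .seq (.instr i) (block l)

/-- The additional step is the `skip` that ends the list. -/
theorem HaltsWith.block {l : List Instr} {s : State} {Q : ℕ → State → Prop}
    (h : Q (l.length + 1) (l.foldl (fun s i => i.exec s) s)) :
    HaltsWith (.block l) s Q := by
  induction l generalizing s Q with
  | nil => exact .skip h
  | cons i l ih =>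
    refine .seq (.instr (ih ?_))
    rw [Nat.add_comm 1]
    exact h

@[simp]
theorem State.reg_setReg (s : State) (x k y : ℕ) :
    (s.setReg x k).reg y = if y = x then k else s.reg y := by
  simp [State.setReg, Function.update_apply]

@[simp]
theorem State.arr_setReg (s : State) (x k : ℕ) : (s.setReg x k).arr = s.arr := rfl

@[simp]
theorem State.reg_setArr (s : State) (a i k : ℕ) : (s.setArr a i k).reg = s.reg := rfl

@[simp]
theorem State.arr_setArr (s : State) (a i k b : ℕ) :
    (s.setArr a i k).arr b = if b = a then Function.update (s.arr a) i k else s.arr b := by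
  by_cases h : b = a
  · subst h
    simp [State.setArr]
  · simp [State.setArr, h]

attribute [simp] Instr.exec Test.holds

/-! ### The representation of the input -/

/-- The arrays `off` and `nb` hold adjacency lists of `G` one after the other. -/
structure Encodes {n : ℕ} (G : SimpleGraph (Fin n)) (deg : Fin n → ℕ) (off nb : ℕ → ℕ) : Prop where
  off_succ : ∀ v : Fin n, off (v + 1) = off v + deg v
  nb_adj : ∀ (v : Fin n) (i : ℕ), off v ≤ i → i < off v + deg v → ∃ u : Fin n, nb i = u ∧ G.Adj v u
  exists_index : ∀ v u : Fin n, G.Adj v u → ∃ i, off v ≤ i ∧ i < off v + deg v ∧ nb i = u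

theorem flatten_getElem?_take {α : Type*} (L : List (List α)) (k j : ℕ) (hk : k < L.length)
    (hj : j < L[k].length) : L.flatten[(L.take k).flatten.length + j]? = some L[k][j] := by
  have h : L = L.take k ++ L[k] :: L.drop (k + 1) := by simp
  conv_lhs => rw [h]
  rw [List.flatten_append, List.flatten_cons]
  simp [List.getElem?_append, hj]

theorem encodes_inputState {n : ℕ} {G : SimpleGraph (Fin n)} {adj : Fin n → List (Fin n)}
    (h : IsAdjacencyList G adj) :
    Encodes G (fun v => (adj v).length) ((inputState adj).arr 0) ((inputState adj).arr 1) := by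
  have hnb : ∀ (v : Fin n) (j : ℕ) (hj : j < (adj v).length),
      (inputState adj).arr 1 ((inputState adj).arr 0 v + j) = (adj v)[j] := by
    intro v j hj
    have h1 := flatten_getElem?_take (List.ofFn adj) v j (by simp) (by simpa using hj)
    have h2 : (inputState adj).arr 1 ((inputState adj).arr 0 v + j) =
        (((List.ofFn adj).flatten.map Fin.val)[((List.ofFn adj).take v).flatten.length + j]?).getD
          0 := rfl
    rw [h2, List.getElem?_map, h1]
    simp
  refine ⟨fun v => ?_, fun v i hi hi' => ?_, fun v u huv => ?_⟩
  · have hlt : (v : ℕ) < (List.ofFn adj).length := by simp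
    simp only [inputState, if_true]
    rw [← List.take_concat_get' _ _ hlt]
    simp
  · obtain ⟨j, rfl⟩ := Nat.exists_eq_add_of_le hi
    have hj : j < (adj v).length := by omega
    exact ⟨(adj v)[j], hnb v j hj, ((h v).2 _).1 (List.getElem_mem hj)⟩
  · obtain ⟨j, hj, rfl⟩ := List.getElem_of_mem (((h v).2 u).2 huv)
    exact ⟨_, Nat.le_add_right _ j, by omega, hnb v j hj⟩

theorem sum_length_adj {n : ℕ} {G : SimpleGraph (Fin n)} {adj : Fin n → List (Fin n)}
    (h : IsAdjacencyList G adj) : ∑ v, (adj v).length = 2 * G.edgeSet.ncard := by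
  classical
  have hd : ∀ v, (adj v).length = G.degree v := by
    intro v
    rw [← List.toFinset_card_of_nodup (h v).1, ← SimpleGraph.card_neighborFinset_eq_degree]
    congr 1
    ext u
    simp [(h v).2 u]
  simp_rw [hd]
  rw [SimpleGraph.sum_degrees_eq_twice_card_edges, ← SimpleGraph.coe_edgeFinset,
    Set.ncard_coe_finset]

/-! ### Breadth-first search -/

/-- The state of a breadth-first search: `vis` has been discovered, the first `t` entries of `Q`
list it in the order of discovery, and the neighbours of the first `h` entries, which form
`done`, have all been discovered. -/
structure Search {n : ℕ} (G : SimpleGraph (Fin n)) (h t : ℕ) (done vis : Finset (Fin n))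
    (pos : Fin n → ℕ) (p : Fin n → Fin n) (Q par : ℕ → ℕ) : Prop where
  par_zero : ∀ v ∉ vis, par v = 0
  par_eq : ∀ v ∈ vis, par v = p v + 1
  queue_pos : ∀ v ∈ vis, Q (pos v) = v
  pos_lt : ∀ v ∈ vis, pos v < t
  exists_pos : ∀ j < t, ∃ v ∈ vis, pos v = j
  parent_mem : ∀ v ∈ vis, p v ∈ vis
  parent_le : ∀ v ∈ vis, pos (p v) ≤ pos v
  -- Makes a vertex enqueued with its parent at the head respect `parent_mono`; it also yields the
  -- bound in `closed` once the head is finished.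
  parent_le_head : ∀ v ∈ vis, pos (p v) ≤ h
  parent_mono : ∀ u ∈ vis, ∀ v ∈ vis, pos u ≤ pos v → pos (p u) ≤ pos (p v)
  parent_adj : ∀ v ∈ vis, p v = v ∨ G.Adj (p v) v
  closed : ∀ u ∈ vis, pos u < h → ∀ x, G.Adj u x → x ∈ vis ∧ pos (p x) ≤ pos u
  head_le : h ≤ t
  mem_done : ∀ v, v ∈ done ↔ v ∈ vis ∧ pos v < h

section Search

variable {n : ℕ} {G : SimpleGraph (Fin n)} {h t : ℕ} {done vis : Finset (Fin n)}
  {pos : Fin n → ℕ} {p : Fin n → Fin n} {Q par : ℕ → ℕ}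

theorem Search.empty (G : SimpleGraph (Fin n)) (hQ : ∀ v : Fin n, par v = 0) :
    Search G 0 0 ∅ ∅ (fun _ => 0) id Q par := by
  constructor <;> simp [hQ]

/-- The new vertex is a root met with an empty queue, or a neighbour of the head. Either way its
parent has position `h`, at least that of every earlier parent. -/
theorem Search.push (hS : Search G h t done vis pos p Q par) {x u : Fin n} (hx : x ∉ vis)
    (hu : u = x ∧ h = t ∨ u ∈ vis ∧ pos u = h ∧ G.Adj u x) :
    Search G h (t + 1) done (insert x vis) (Function.update pos x t) (Function.update p x u)
      (Function.update Q t x) (Function.update par x (u + 1)) := by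
  have ne : ∀ {v}, v ∈ vis → v ≠ x := fun hv e => hx (e ▸ hv)
  have nev : ∀ {v : Fin n}, v ∈ vis → (v : ℕ) ≠ x := fun hv e => ne hv (Fin.ext e)
  have hpu : Function.update pos x t u = h ∧ (u = x ∨ u ∈ vis ∧ G.Adj u x) := by
    rcases hu with ⟨rfl, rfl⟩ | ⟨h1, h2, h3⟩
    · simp
    · simp [ne h1, h2, h1, h3]
  have hht := hS.head_le
  have pv : ∀ v ∈ vis, Function.update pos x t v = pos v :=
    fun v hv => Function.update_of_ne (ne hv) _ _
  have ppv : ∀ v ∈ vis, Function.update p x u v = p v :=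
    fun v hv => Function.update_of_ne (ne hv) _ _
  have px : Function.update pos x t x = t := Function.update_self _ _ _
  have ppx : Function.update p x u x = u := Function.update_self _ _ _
  constructor
  · intro v hv
    rw [Finset.mem_insert, not_or] at hv
    rw [Function.update_of_ne (fun e => hv.1 (Fin.ext e))]
    exact hS.par_zero v hv.2
  · intro v hv
    rcases Finset.mem_insert.1 hv with rfl | hv
    · simp
    · rw [Function.update_of_ne (nev hv), ppv v hv]
      exact hS.par_eq v hv
  · intro v hv
    rcases Finset.mem_insert.1 hv with rfl | hv
    · simp
    · rw [pv v hv, Function.update_of_ne (hS.pos_lt v hv).ne]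
      exact hS.queue_pos v hv
  · intro v hv
    rcases Finset.mem_insert.1 hv with rfl | hv
    · rw [px]; omega
    · rw [pv v hv]
      exact (hS.pos_lt v hv).trans (Nat.lt_succ_self _)
  · intro j hj
    rcases Nat.lt_succ_iff_lt_or_eq.1 hj with hj | rfl
    · obtain ⟨v, hv, rfl⟩ := hS.exists_pos j hj
      exact ⟨v, Finset.mem_insert_of_mem hv, pv v hv⟩
    · exact ⟨x, Finset.mem_insert_self _ _, px⟩
  · intro v hv
    rcases Finset.mem_insert.1 hv with rfl | hv
    · rw [ppx]
      exact Finset.mem_insert.2 (hpu.2.imp id And.left)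
    · rw [ppv v hv]
      exact Finset.mem_insert_of_mem (hS.parent_mem v hv)
  · intro v hv
    rcases Finset.mem_insert.1 hv with rfl | hv
    · rw [ppx, px, hpu.1]
      exact hht
    · rw [ppv v hv, pv v hv, pv _ (hS.parent_mem v hv)]
      exact hS.parent_le v hv
  · intro v hv
    rcases Finset.mem_insert.1 hv with rfl | hv
    · rw [ppx, hpu.1]
    · rw [ppv v hv, pv _ (hS.parent_mem v hv)]
      exact hS.parent_le_head v hv
  · intro v hv w hw
    rcases Finset.mem_insert.1 hv with rfl | hv' <;> rcases Finset.mem_insert.1 hw with rfl | hw'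
    · exact fun _ => le_rfl
    · rw [px, pv w hw']
      intro hle
      exact absurd (hS.pos_lt w hw') (by omega)
    · rw [ppv v hv', pv _ (hS.parent_mem v hv'), ppx, hpu.1]
      exact fun _ => hS.parent_le_head v hv'
    · rw [ppv v hv', pv _ (hS.parent_mem v hv'), ppv w hw', pv _ (hS.parent_mem w hw'), pv v hv',
        pv w hw']
      exact hS.parent_mono v hv' w hw'
  · intro v hv
    rcases Finset.mem_insert.1 hv with rfl | hv
    · rw [ppx]
      exact hpu.2.imp id And.right
    · rw [ppv v hv]
      exact hS.parent_adj v hv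
  · intro v hv
    rcases Finset.mem_insert.1 hv with rfl | hv
    · rw [px]
      intro hlt
      omega
    · rw [pv v hv]
      intro hlt y hy
      obtain ⟨h1, h2⟩ := hS.closed v hv hlt y hy
      rw [ppv y h1, pv _ (hS.parent_mem y h1)]
      exact ⟨Finset.mem_insert_of_mem h1, h2⟩
  · omega
  · intro v
    rw [hS.mem_done v, Finset.mem_insert]
    constructor
    · rintro ⟨h1, h2⟩
      rw [pv v h1]
      exact ⟨Or.inr h1, h2⟩
    · rintro ⟨rfl | h1, h2⟩
      · rw [px] at h2
        omega
      · rw [pv v h1] at h2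
        exact ⟨h1, h2⟩

theorem Search.pos_injOn (hS : Search G h t done vis pos p Q par) {u v : Fin n} (hu : u ∈ vis)
    (hv : v ∈ vis) (huv : pos u = pos v) : u = v :=
  Fin.ext (by rw [← hS.queue_pos u hu, ← hS.queue_pos v hv, huv])

/-- `u ∉ done` ensures that each vertex pays for its adjacency list only once. -/
theorem Search.advance (hS : Search G h t done vis pos p Q par) {u : Fin n} (hu : u ∈ vis)
    (hpu : pos u = h) (hadj : ∀ x, G.Adj u x → x ∈ vis) :
    u ∉ done ∧ Search G (h + 1) t (insert u done) vis pos p Q par := by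
  refine ⟨fun hd => ?_, { hS with
    parent_le_head := ?_
    closed := ?_
    head_le := ?_
    mem_done := ?_ }⟩
  · have := ((hS.mem_done u).1 hd).2
    omega
  · exact fun v hv => (hS.parent_le_head v hv).trans (Nat.le_succ _)
  · intro v hv hlt x hx
    rcases Nat.lt_succ_iff_lt_or_eq.1 hlt with hlt | he
    · exact hS.closed v hv hlt x hx
    · obtain rfl := hS.pos_injOn hu hv (hpu.trans he.symm)
      rw [he]
      exact ⟨hadj x hx, hS.parent_le_head x (hadj x hx)⟩
  · have := hS.pos_lt u hu
    omega
  · intro v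
    rw [Finset.mem_insert, hS.mem_done v]
    constructor
    · rintro (rfl | ⟨h1, h2⟩)
      · exact ⟨hu, by omega⟩
      · exact ⟨h1, by omega⟩
    · rintro ⟨h1, h2⟩
      rcases Nat.lt_succ_iff_lt_or_eq.1 h2 with h2 | h2
      · exact Or.inr ⟨h1, h2⟩
      · exact Or.inl (hS.pos_injOn h1 hu (h2.trans hpu.symm))

theorem Search.isBreadthFirst (hS : Search G t t done vis pos p Q par) (hvis : ∀ v, v ∈ vis) :
    IsBreadthFirst G pos p where
  injective u v huv := hS.pos_injOn (hvis u) (hvis v) huv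
  parent_le v := hS.parent_le v (hvis v)
  parent_mono u v := hS.parent_mono u (hvis u) v (hvis v)
  parent_adj v := hS.parent_adj v (hvis v)
  parent_min u v huv := (hS.closed u (hvis u) (hS.pos_lt u (hvis u)) v huv).2

end Search

/-! ### The program for breadth-first search

Array `3` holds the successor of the parent of each discovered vertex, array `4` is the queue, with
head in register `3` and tail in register `4`. Register `10` is never written. -/

/-- Scan the adjacency list at the positions from register `6` up to register `7`, and enqueue the
vertices that have not yet been discovered. -/
def discoverNeighbours : Program :=
  .loop (.lt 6 7) (.seq (.block [.load 8 1 6, .load 9 3 8])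
    (.seq (.ifElse (.eq 9 10) (.block [.store 3 8 11, .store 4 4 8, .succ 4]) .skip)
      (.instr (.succ 6))))

/-- Treat the vertices of the queue until it is exhausted. -/
def searchComponent : Program :=
  .loop (.lt 3 4)
    (.seq (.block [.load 5 4 3, .load 6 0 5, .copy 11 5, .succ 11, .load 7 0 11])
      (.seq discoverNeighbours (.instr (.succ 3))))

/-- Search from each vertex that has not yet been discovered. -/
def breadthFirstSearch : Program :=
  .loop (.lt 2 0) (.seq (.block [.load 9 3 2, .copy 11 2, .succ 11])
    (.seq (.ifElse (.eq 9 10)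
        (.seq (.block [.store 3 2 11, .store 4 4 2, .succ 4]) searchComponent) .skip)
      (.instr (.succ 2))))

/-- The part of the memory that a breadth-first search does not change. -/
structure SearchFrame (n : ℕ) (off nb : ℕ → ℕ) (s : State) : Prop where
  size : s.reg 0 = n
  count : s.reg 1 = 0
  zero : s.reg 10 = 0
  off : s.arr 0 = off
  nb : s.arr 1 = nb
  uncovered : ∀ i, s.arr 5 i = 0

section

variable {n : ℕ} {G : SimpleGraph (Fin n)} {deg : Fin n → ℕ} {off nb : ℕ → ℕ}

/-- Cost per entry: 1 for the loop test, 3 for the loads, at most 5 for the conditional, 1 for the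
increment. -/
theorem discoverNeighbours_spec (hE : Encodes G deg off nb) {h : ℕ} {done vis : Finset (Fin n)}
    {pos : Fin n → ℕ} {p : Fin n → Fin n} {s : State} {u : Fin n}
    (hF : SearchFrame n off nb s) (h3 : s.reg 3 = h)
    (h6 : s.reg 6 = off u) (h7 : s.reg 7 = off u + deg u) (h11 : s.reg 11 = u + 1)
    (hS : Search G h (s.reg 4) done vis pos p (s.arr 4) (s.arr 3)) (hu : u ∈ vis)
    (hpu : pos u = h) :
    HaltsWith discoverNeighbours s fun t s' => t ≤ 10 * deg u + 1 ∧ SearchFrame n off nb s' ∧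
      s'.reg 2 = s.reg 2 ∧ s'.reg 3 = h ∧ ∃ vis' pos' p',
        Search G h (s'.reg 4) done vis' pos' p' (s'.arr 4) (s'.arr 3) ∧ vis ⊆ vis' ∧
        pos' u = h ∧ ∀ x, G.Adj u x → x ∈ vis' := by
  refine (HaltsWith.loop (fun t s' => SearchFrame n off nb s' ∧ s'.reg 2 = s.reg 2 ∧
    s'.reg 3 = h ∧ s'.reg 7 = off u + deg u ∧ s'.reg 11 = u + 1 ∧ ∃ k, s'.reg 6 = off u + k ∧
      k ≤ deg u ∧ t ≤ 10 * k ∧ ∃ vis' pos' p',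
        Search G h (s'.reg 4) done vis' pos' p' (s'.arr 4) (s'.arr 3) ∧ vis ⊆ vis' ∧
        pos' u = h ∧ ∀ j < k, ∃ x ∈ vis', nb (off u + j) = x) (10 * deg u) ?_ ?_ ?_).mono ?_
  · exact ⟨hF, rfl, h3, h7, h11, 0, h6, Nat.zero_le _, le_rfl, vis, pos, p, hS,
      Finset.Subset.refl _, hpu, by simp⟩
  · rintro t s' ⟨-, -, -, -, -, k, -, hk, ht, -⟩
    omega
  · rintro t s₁ ⟨hF₁, h2, h3, h7, h11, k, h6, hk, ht, vis', pos', p', hS', hsub, hpu', hall⟩ hb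
    simp only [Test.holds, h6, h7] at hb
    obtain ⟨x, hx, hux⟩ := hE.nb_adj u (off u + k) (by omega) (by omega)
    refine .seq (.block (.seq (.ifElse ?_ ?_)))
    · intro hz
      simp [hF₁.nb, h6, hx, hF₁.zero] at hz
      have hxv : x ∉ vis' := by
        intro hm
        rw [hS'.par_eq x hm] at hz
        omega
      refine .block (.instr ?_)
      refine ⟨⟨by simpa using hF₁.size, by simpa using hF₁.count, by simpa using hF₁.zero,
        by simpa using hF₁.off, by simpa using hF₁.nb, by simpa using hF₁.uncovered⟩,
        by simpa using h2, by simpa using h3, by simpa using h7, by simpa using h11, k + 1,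
        by simp [h6, Nat.add_assoc], by omega, by simp; omega, _, _, _,
        by simpa [hF₁.nb, h6, hx, h11] using
          hS'.push hxv (Or.inr ⟨hsub hu, hpu', hux⟩),
        hsub.trans (Finset.subset_insert _ _), ?_, ?_⟩
      · rwa [Function.update_of_ne]
        rintro rfl
        exact hxv (hsub hu)
      · intro j hj
        rcases Nat.lt_succ_iff_lt_or_eq.1 hj with hj | rfl
        · obtain ⟨y, hy, he⟩ := hall j hj
          exact ⟨y, Finset.mem_insert_of_mem hy, he⟩
        · exact ⟨x, Finset.mem_insert_self _ _, hx⟩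
    · intro hz
      simp [hF₁.nb, h6, hx, hF₁.zero] at hz
      refine .skip (.instr ?_)
      refine ⟨⟨by simpa using hF₁.size, by simpa using hF₁.count, by simpa using hF₁.zero,
        by simpa using hF₁.off, by simpa using hF₁.nb, by simpa using hF₁.uncovered⟩,
        by simpa using h2, by simpa using h3, by simpa using h7, by simpa using h11, k + 1,
        by simp [h6, Nat.add_assoc], by omega, by simp; omega, vis', pos', p',
        by simpa using hS', hsub, hpu', ?_⟩
      intro j hj
      rcases Nat.lt_succ_iff_lt_or_eq.1 hj with hj | rfl
      · exact hall j hj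
      · exact ⟨x, by_contra fun hm => hz (hS'.par_zero x hm), hx⟩
  · rintro t s' ⟨t', rfl, ⟨hF', h2, h3, h7, h11, k, h6, hk, ht, vis', pos', p', hS', hsub, hpu',
      hall⟩, hb⟩
    simp only [Test.holds, h6, h7] at hb
    refine ⟨by omega, hF', h2, h3, vis', pos', p', hS', hsub, hpu', fun x hx => ?_⟩
    obtain ⟨i, hi, hi', hnbi⟩ := hE.exists_index u x hx
    obtain ⟨j, rfl⟩ := Nat.exists_eq_add_of_le hi
    obtain ⟨y, hy, he⟩ := hall j (by omega)
    rwa [Fin.ext (hnbi.symm.trans he)]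

/-- The time is amortised over `done`: a vertex entering it pays `10 * deg v + 1` for its scan and 8
for the rest of the iteration. Summing over all vertices bounds the loop. -/
theorem searchComponent_spec (hE : Encodes G deg off nb) {done vis : Finset (Fin n)}
    {pos : Fin n → ℕ} {p : Fin n → Fin n} {s : State} (hF : SearchFrame n off nb s)
    (hS : Search G (s.reg 3) (s.reg 4) done vis pos p (s.arr 4) (s.arr 3)) :
    HaltsWith searchComponent s fun t s' => SearchFrame n off nb s' ∧ s'.reg 2 = s.reg 2 ∧
      s'.reg 3 = s'.reg 4 ∧ ∃ done' vis' pos' p',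
        Search G (s'.reg 3) (s'.reg 4) done' vis' pos' p' (s'.arr 4) (s'.arr 3) ∧ vis ⊆ vis' ∧
        t + ∑ v ∈ done, (10 * deg v + 9) ≤ ∑ v ∈ done', (10 * deg v + 9) + 1 := by
  refine (HaltsWith.loop (fun t s' => SearchFrame n off nb s' ∧ s'.reg 2 = s.reg 2 ∧
      ∃ done' vis' pos' p',
        Search G (s'.reg 3) (s'.reg 4) done' vis' pos' p' (s'.arr 4) (s'.arr 3) ∧ vis ⊆ vis' ∧
        t + ∑ v ∈ done, (10 * deg v + 9) ≤ ∑ v ∈ done', (10 * deg v + 9))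
    (∑ v, (10 * deg v + 9)) ?_ ?_ ?_).mono ?_
  · exact ⟨hF, rfl, done, vis, pos, p, hS, Finset.Subset.refl _, by omega⟩
  · rintro t s' ⟨-, -, done', -, -, -, -, -, ht⟩
    have := Finset.sum_le_univ_sum_of_nonneg (s := done') (f := fun v => 10 * deg v + 9)
      fun _ => Nat.zero_le _
    omega
  · rintro t s₁ ⟨hF₁, h2, done', vis', pos', p', hS', hsub, ht⟩ hb
    simp only [Test.holds] at hb
    obtain ⟨u, hu, hpu⟩ := hS'.exists_pos _ hb
    have hq : s₁.arr 4 (s₁.reg 3) = u := by rw [← hpu, hS'.queue_pos u hu]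
    refine .seq (.block (.seq ((discoverNeighbours_spec hE (h := s₁.reg 3) (u := u)
      ⟨by simpa using hF₁.size, by simpa using hF₁.count, by simpa using hF₁.zero,
        by simpa using hF₁.off, by simpa using hF₁.nb, by simpa using hF₁.uncovered⟩
      (by simp) (by simp [hq, hF₁.off]) (by simp [hq, hF₁.off, hE.off_succ]) (by simp [hq])
      (by simpa using hS') hu hpu).mono ?_)))
    rintro t₂ s₂ ⟨ht₂, hF₂, h2', h3', vis₂, pos₂, p₂, hS₂, hsub₂, hpu₂, hall⟩
    refine .instr ?_
    obtain ⟨hud, hS₃⟩ := hS₂.advance (hsub₂ hu) hpu₂ hall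
    refine ⟨⟨by simpa using hF₂.size, by simpa using hF₂.count, by simpa using hF₂.zero,
        by simpa using hF₂.off, by simpa using hF₂.nb, by simpa using hF₂.uncovered⟩,
        by simpa [h2] using h2', insert u done', vis₂, pos₂, p₂, by simpa [h3'] using hS₃,
        hsub.trans hsub₂, ?_⟩
    rw [Finset.sum_insert hud]
    simp only [List.length_cons, List.length_nil]
    omega
  · rintro t s' ⟨t', rfl, ⟨hF', h2, done', vis', pos', p', hS', hsub, ht⟩, hb⟩
    simp only [Test.holds] at hb
    exact ⟨hF', h2, le_antisymm hS'.head_le (not_lt.1 hb), done', vis', pos', p', hS', hsub,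
      by omega⟩

theorem breadthFirstSearch_spec (hE : Encodes G deg off nb) {s : State}
    (hF : SearchFrame n off nb s) (h2 : s.reg 2 = 0) (h3 : s.reg 3 = 0) (h4 : s.reg 4 = 0)
    (hpar : ∀ i, s.arr 3 i = 0) :
    HaltsWith breadthFirstSearch s fun t s' => SearchFrame n off nb s' ∧
      t ≤ ∑ v, (10 * deg v + 9) + 12 * n + 1 ∧ ∃ done vis pos p,
        Search G (s'.reg 3) (s'.reg 3) done vis pos p (s'.arr 4) (s'.arr 3) ∧ ∀ v, v ∈ vis := by
  have hsum : ∀ d : Finset (Fin n), ∑ v ∈ d, (10 * deg v + 9) ≤ ∑ v, (10 * deg v + 9) :=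
    fun d => Finset.sum_le_univ_sum_of_nonneg fun _ => Nat.zero_le _
  -- Queue work is charged to `done` across all components; the outer loop costs at most 12 more per
  -- vertex, including the final test of `searchComponent`.
  refine (HaltsWith.loop (fun t s' => SearchFrame n off nb s' ∧ s'.reg 2 ≤ n ∧
      s'.reg 3 = s'.reg 4 ∧ ∃ done vis pos p,
        Search G (s'.reg 3) (s'.reg 4) done vis pos p (s'.arr 4) (s'.arr 3) ∧
        (∀ v : Fin n, v < s'.reg 2 → v ∈ vis) ∧
        t ≤ ∑ v ∈ done, (10 * deg v + 9) + 12 * s'.reg 2)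
    (∑ v, (10 * deg v + 9) + 12 * n) ?_ ?_ ?_).mono ?_
  · refine ⟨hF, by omega, by omega, ∅, ∅, fun _ => 0, id, ?_, by simp [h2], by simp⟩
    rw [h3, h4]
    exact Search.empty G fun v => hpar v
  · rintro t s' ⟨-, h2, -, done, -, -, -, -, -, ht⟩
    have := hsum done
    omega
  · rintro t s₁ ⟨hF₁, h2, h34, done, vis, pos, p, hS, hall, ht⟩ hb
    simp only [Test.holds, hF₁.size] at hb
    obtain ⟨r, hr⟩ : ∃ r : Fin n, s₁.reg 2 = r := ⟨⟨_, hb⟩, rfl⟩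
    refine .seq (.block (.seq (.ifElse ?_ ?_)))
    · intro hz
      simp [hr, hF₁.zero] at hz
      have hrv : r ∉ vis := by
        intro hm
        rw [hS.par_eq r hm] at hz
        omega
      refine .seq (.block ((searchComponent_spec hE (done := done) (vis := insert r vis)
        (pos := Function.update pos r (s₁.reg 4)) (p := Function.update p r r)
        ⟨by simpa using hF₁.size, by simpa using hF₁.count, by simpa using hF₁.zero,
        by simpa using hF₁.off, by simpa using hF₁.nb, by simpa using hF₁.uncovered⟩
        (by simpa [hr] using hS.push hrv (Or.inl ⟨rfl, h34⟩))).mono ?_))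
      rintro t₂ s₂ ⟨hF₂, h2', h34', done₂, vis₂, pos₂, p₂, hS₂, hsub₂, ht₂⟩
      simp at h2'
      refine .instr ⟨⟨by simpa using hF₂.size, by simpa using hF₂.count, by simpa using hF₂.zero,
        by simpa using hF₂.off, by simpa using hF₂.nb, by simpa using hF₂.uncovered⟩,
        by simp [h2']; omega, by simpa using h34', done₂, vis₂, pos₂, p₂, by simpa using hS₂,
        ?_, ?_⟩
      · intro v hv
        simp [h2'] at hv
        rcases hv.lt_or_eq with hv | hv
        · exact hsub₂ (Finset.mem_insert_of_mem (hall v hv))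
        · rw [hr] at hv
          rw [Fin.ext hv]
          exact hsub₂ (Finset.mem_insert_self _ _)
      · simp [h2']
        omega
    · intro hz
      simp [hr, hF₁.zero] at hz
      refine .skip (.instr ⟨⟨by simpa using hF₁.size, by simpa using hF₁.count,
        by simpa using hF₁.zero, by simpa using hF₁.off, by simpa using hF₁.nb,
        by simpa using hF₁.uncovered⟩, by simp; omega, by simpa using h34, done, vis, pos, p,
        by simpa using hS, ?_, ?_⟩)
      · intro v hv
        simp at hv
        rcases hv.lt_or_eq with hv | hv
        · exact hall v hv
        · rw [hr] at hv
          rw [Fin.ext hv]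
          exact by_contra fun hm => hz (hS.par_zero r hm)
      · simp
        omega
  · rintro t s' ⟨t', rfl, ⟨hF', h2, h34, done, vis, pos, p, hS, hall, ht⟩, hb⟩
    simp only [Test.holds, hF'.size] at hb
    have := hsum done
    refine ⟨hF', by omega, done, vis, pos, p, ?_, fun v => hall v (by have := v.2; omega)⟩
    rw [← h34] at hS
    exact hS

end

/-! ### The program for the greedy selection

Array `5` marks the vertices in the closed neighbourhood of the selected set. -/

/-- Scan the adjacency list at the positions from register `6` up to register `7`, and set
register `12` if it has an unmarked vertex other than the one in register `11`. -/
def findUncovered : Program :=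
  .loop (.lt 6 7) (.seq (.block [.load 8 1 6, .load 9 5 8])
    (.seq (.ifElse (.eq 9 10) (.ifElse (.eq 8 11) .skip (.instr (.const 12 1))) .skip)
      (.instr (.succ 6))))

/-- Mark the vertices of the adjacency list at the positions from register `6` up to
register `7`. -/
def markNeighbours : Program :=
  .loop (.lt 6 7) (.block [.load 8 1 6, .store 5 8 13, .succ 6])

/-- Select the vertex in register `11` and mark its closed neighbourhood. -/
def selectVertex : Program :=
  .seq (.block [.store 2 1 11, .succ 1, .const 13 1, .store 5 11 13, .load 6 0 11, .copy 7 11,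
    .succ 7, .load 7 0 7]) markNeighbours

/-- Treat the vertices of the queue in reverse order. A vertex is treated by selecting its parent
if the vertex is unmarked and has an unmarked neighbour other than its parent. -/
def greedySelection : Program :=
  .loop (.lt 10 3) (.seq (.block [.pred 3, .load 5 4 3, .load 9 5 5])
    (.ifElse (.eq 9 10)
      (.seq (.block [.load 11 3 5, .pred 11, .const 12 0, .load 6 0 5, .copy 7 5, .succ 7,
          .load 7 0 7])
        (.seq findUncovered (.ifElse (.eq 12 10) .skip selectVertex)))
      .skip))

/-- The part of the memory that the greedy selection does not change. -/
structure SelectionFrame (off nb par Q : ℕ → ℕ) (s : State) : Prop where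
  zero : s.reg 10 = 0
  off : s.arr 0 = off
  nb : s.arr 1 = nb
  par : s.arr 3 = par
  queue : s.arr 4 = Q

section

variable {n : ℕ} {G : SimpleGraph (Fin n)} {deg : Fin n → ℕ} {off nb par Q : ℕ → ℕ}

/-- Cost per entry: 1 for the loop test, 3 for the loads, at most 3 for the two conditionals, 1 for
the increment. -/
theorem findUncovered_spec (hE : Encodes G deg off nb) {s : State} {v w : Fin n}
    (h1 : s.arr 1 = nb) (h10 : s.reg 10 = 0)
    (h6 : s.reg 6 = off v) (h7 : s.reg 7 = off v + deg v) (h11 : s.reg 11 = w)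
    (h12 : s.reg 12 = 0) :
    HaltsWith findUncovered s fun t s' => t ≤ 8 * deg v + 1 ∧ s'.arr = s.arr ∧
      s'.reg 1 = s.reg 1 ∧ s'.reg 3 = s.reg 3 ∧ s'.reg 10 = 0 ∧ s'.reg 11 = w ∧
      (s'.reg 12 = 0 ↔ ∀ x, G.Adj v x → s.arr 5 x = 0 → x = w) := by
  refine (HaltsWith.loop (fun t s' => s'.arr = s.arr ∧
      s'.reg 1 = s.reg 1 ∧ s'.reg 3 = s.reg 3 ∧ s'.reg 10 = 0 ∧ s'.reg 11 = w ∧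
      s'.reg 7 = off v + deg v ∧ ∃ k, s'.reg 6 = off v + k ∧ k ≤ deg v ∧ t ≤ 8 * k ∧
      (s'.reg 12 = 0 ↔ ∀ j < k, s.arr 5 (nb (off v + j)) = 0 → nb (off v + j) = w))
    (8 * deg v) ?_ ?_ ?_).mono ?_
  · exact ⟨rfl, rfl, rfl, h10, h11, h7, 0, h6, Nat.zero_le _, le_rfl, by simp [h12]⟩
  · rintro t s' ⟨-, -, -, -, -, -, k, -, hk, ht, -⟩
    omega
  · rintro t s₁ ⟨ha, hr1, hr3, hr10, hr11, hr7, k, hr6, hk, ht, hall⟩ hb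
    simp only [Test.holds, hr6, hr7] at hb
    have split : ∀ P : ℕ → Prop, (∀ j < k + 1, P j) ↔ (∀ j < k, P j) ∧ P k := by
      intro P
      simp only [Nat.lt_succ_iff_lt_or_eq, or_imp, forall_and, forall_eq]
    refine .seq (.block (.seq (.ifElse ?_ ?_)))
    · intro hz
      simp [ha, h1, hr6, hr10] at hz
      refine .ifElse ?_ ?_
      · intro he
        simp [ha, h1, hr6, hr11] at he
        refine .skip (.instr ⟨by simpa using ha, by simpa using hr1, by simpa using hr3,
          by simpa using hr10, by simpa using hr11, by simpa using hr7, k + 1,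
          by simp [hr6, Nat.add_assoc], by omega, by simp; omega, ?_⟩)
        rw [split]
        simpa [he] using hall
      · intro he
        simp [ha, h1, hr6, hr11] at he
        refine .instr (.instr ⟨by simpa using ha, by simpa using hr1, by simpa using hr3,
          by simpa using hr10, by simpa using hr11, by simpa using hr7, k + 1,
          by simp [hr6, Nat.add_assoc], by omega, by simp; omega, ?_⟩)
        rw [split]
        simp [he, hz]
    · intro hz
      simp [ha, h1, hr6, hr10] at hz
      refine .skip (.instr ⟨by simpa using ha, by simpa using hr1, by simpa using hr3,
        by simpa using hr10, by simpa using hr11, by simpa using hr7, k + 1,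
        by simp [hr6, Nat.add_assoc], by omega, by simp; omega, ?_⟩)
      rw [split]
      simpa [hz] using hall
  · rintro t s' ⟨t', rfl, ⟨ha, hr1, hr3, hr10, hr11, hr7, k, hr6, hk, ht, hall⟩, hb⟩
    simp only [Test.holds, hr6, hr7] at hb
    obtain rfl : k = deg v := by omega
    refine ⟨by omega, ha, hr1, hr3, hr10, hr11, hall.trans ⟨fun H x hx hz => ?_,
      fun H j hj hz => ?_⟩⟩
    · obtain ⟨i, hi, hi', he⟩ := hE.exists_index v x hx
      obtain ⟨j, rfl⟩ := Nat.exists_eq_add_of_le hi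
      have := H j (by omega)
      rw [he] at this
      exact Fin.ext (this hz)
    · obtain ⟨x, hx, hvx⟩ := hE.nb_adj v (off v + j) (by omega) (by omega)
      rw [hx] at hz ⊢
      rw [H x hvx hz]

theorem markNeighbours_spec (hE : Encodes G deg off nb) {s : State} {w : Fin n}
    (hF : SelectionFrame off nb par Q s)
    (h6 : s.reg 6 = off w) (h7 : s.reg 7 = off w + deg w) (h13 : s.reg 13 = 1) :
    HaltsWith markNeighbours s fun t s' => t ≤ 5 * deg w + 1 ∧ SelectionFrame off nb par Q s' ∧
      s'.reg 1 = s.reg 1 ∧ s'.reg 3 = s.reg 3 ∧ s'.arr 2 = s.arr 2 ∧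
      ∀ y : Fin n, s'.arr 5 y = 0 ↔ s.arr 5 y = 0 ∧ ¬ G.Adj w y := by
  refine (HaltsWith.loop (fun t s' => SelectionFrame off nb par Q s' ∧
      s'.reg 1 = s.reg 1 ∧ s'.reg 3 = s.reg 3 ∧ s'.arr 2 = s.arr 2 ∧
      s'.reg 7 = off w + deg w ∧ s'.reg 13 = 1 ∧ ∃ k, s'.reg 6 = off w + k ∧ k ≤ deg w ∧
      t ≤ 5 * k ∧ ∀ y, s'.arr 5 y = 0 ↔ s.arr 5 y = 0 ∧ ∀ j < k, nb (off w + j) ≠ y)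
    (5 * deg w) ?_ ?_ ?_).mono ?_
  · exact ⟨hF, rfl, rfl, rfl, h7, h13, 0, h6, Nat.zero_le _, le_rfl, by simp⟩
  · rintro t s' ⟨-, -, -, -, -, -, k, -, hk, ht, -⟩
    omega
  · rintro t s₁ ⟨hF₁, hr1, hr3, ha2, hr7, hr13, k, hr6, hk, ht, hall⟩ hb
    simp only [Test.holds, hr6, hr7] at hb
    refine .block ⟨⟨by simpa using hF₁.zero, by simpa using hF₁.off, by simpa using hF₁.nb,
      by simpa using hF₁.par, by simpa using hF₁.queue⟩, by simpa using hr1, by simpa using hr3,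
      by simpa using ha2, by simpa using hr7, by simpa using hr13, k + 1,
      by simp [hr6, Nat.add_assoc], by omega, by simp; omega, fun y => ?_⟩
    simp only [Nat.lt_succ_iff_lt_or_eq, or_imp, forall_and, forall_eq]
    by_cases hy : y = nb (off w + k)
    · simp [hF₁.nb, hr6, hr13, hy]
    · have hy' : nb (off w + k) ≠ y := fun e => hy e.symm
      simp [hF₁.nb, hr6, Function.update_of_ne hy, hall, hy']
  · rintro t s' ⟨t', rfl, ⟨hF₁, hr1, hr3, ha2, hr7, hr13, k, hr6, hk, ht, hall⟩, hb⟩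
    simp only [Test.holds, hr6, hr7] at hb
    obtain rfl : k = deg w := by omega
    refine ⟨by omega, hF₁, hr1, hr3, ha2, fun y => (hall y).trans (and_congr_right fun _ =>
      ⟨fun H hy => ?_, fun H j hj hy => ?_⟩)⟩
    · obtain ⟨i, hi, hi', he⟩ := hE.exists_index w y hy
      obtain ⟨j, rfl⟩ := Nat.exists_eq_add_of_le hi
      exact H j (by omega) he
    · obtain ⟨x, hx, hvx⟩ := hE.nb_adj w (off w + j) (by omega) (by omega)
      rw [hx] at hy
      exact H (Fin.ext hy ▸ hvx)

theorem selectVertex_spec (hE : Encodes G deg off nb) {s : State} {w : Fin n}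
    (hF : SelectionFrame off nb par Q s) (h11 : s.reg 11 = w) :
    HaltsWith selectVertex s fun t s' => t ≤ 5 * deg w + 10 ∧ SelectionFrame off nb par Q s' ∧
      s'.reg 1 = s.reg 1 + 1 ∧ s'.reg 3 = s.reg 3 ∧
      s'.arr 2 = Function.update (s.arr 2) (s.reg 1) w ∧
      ∀ y : Fin n, s'.arr 5 y = 0 ↔ s.arr 5 y = 0 ∧ ¬ (w = y ∨ G.Adj w y) := by
  refine .seq (.block ((markNeighbours_spec hE (w := w) (par := par) (Q := Q)
    ⟨by simpa using hF.zero, by simpa using hF.off, by simpa using hF.nb,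
      by simpa using hF.par, by simpa using hF.queue⟩
    (by simp [hF.off, h11]) (by simp [hF.off, h11, hE.off_succ]) (by simp)).mono ?_))
  rintro t s' ⟨ht, hF', hr1, hr3, ha2, hcov⟩
  refine ⟨by simp; omega, hF', by simpa using hr1, by simpa using hr3,
    by simpa [h11] using ha2, fun y => ?_⟩
  rw [hcov y, not_or, ← and_assoc]
  refine and_congr_left fun _ => ?_
  by_cases hy : w = y
  · simp [h11, hy]
  · have hy' : (y : ℕ) ≠ w := fun e => hy (Fin.ext e.symm)
    simp [h11, hy, Function.update_of_ne hy']

theorem Outputs.insert {s s' : State} {S : Finset (Fin n)} {w : Fin n} (h : Outputs s S)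
    (hw : w ∉ S) (h1 : s'.reg 1 = s.reg 1 + 1)
    (h2 : s'.arr 2 = Function.update (s.arr 2) (s.reg 1) w) : Outputs s' (insert w S) := by
  refine ⟨by rw [h1, h.1, Finset.card_insert_of_notMem hw], fun v => ?_⟩
  rw [Finset.mem_insert, h.2 v, h1, h2]
  constructor
  · rintro (rfl | ⟨i, hi, he⟩)
    · exact ⟨s.reg 1, Nat.lt_succ_self _, by simp⟩
    · exact ⟨i, by omega, by rwa [Function.update_of_ne hi.ne]⟩
  · rintro ⟨i, hi, he⟩
    rcases Nat.lt_succ_iff_lt_or_eq.1 hi with hi | rfl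
    · rw [Function.update_of_ne hi.ne] at he
      exact Or.inr ⟨i, hi, he⟩
    · rw [Function.update_self] at he
      exact Or.inl (Fin.ext he.symm)

theorem Outputs.congr {s s' : State} {S : Finset (Fin n)} (h : Outputs s S)
    (h1 : s'.reg 1 = s.reg 1) (h2 : s'.arr 2 = s.arr 2) : Outputs s' S := by
  unfold Outputs at *
  rwa [h1, h2]

theorem greedySelection_spec (hE : Encodes G deg off nb) (hG : IsBlockGraph G)
    {pos : Fin n → ℕ} {p : Fin n → Fin n} (hB : IsBreadthFirst G pos p) {s : State}
    (hF : SelectionFrame off nb par Q s) (hpar : ∀ v : Fin n, par v = p v + 1)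
    (hQ : ∀ v : Fin n, Q (pos v) = v) (hlt : ∀ v, pos v < s.reg 3)
    (hpos : ∀ j < s.reg 3, ∃ v, pos v = j) (h1 : s.reg 1 = 0) (h5 : ∀ i, s.arr 5 i = 0) :
    HaltsWith greedySelection s fun t s' =>
      t ≤ ∑ v, (8 * deg v + 17) + ∑ v, (5 * deg v + 10) + 1 ∧
      ∃ S, Outputs s' S ∧ IsMinimumVEDominatingSet G S := by
  have hsum : ∀ (f : Fin n → ℕ) (d : Finset (Fin n)), ∑ v ∈ d, f v ≤ ∑ v, f v :=
    fun f d => Finset.sum_le_univ_sum_of_nonneg fun _ => Nat.zero_le _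
  -- Register `3` is the threshold of `GreedyInvariant`. A treated vertex pays `8 * deg v + 17`, a
  -- selected one `5 * deg v + 10`; the latter is a sum over `S` because a vertex with many children
  -- is still selected once.
  refine (HaltsWith.loop (fun t s' => SelectionFrame off nb par Q s' ∧ s'.reg 3 ≤ s.reg 3 ∧
      ∃ S F, GreedyInvariant G pos p (s'.reg 3) S F ∧ Outputs s' S ∧
        (∀ v : Fin n, s'.arr 5 v = 0 ↔ ¬ Covered G S v) ∧
        t ≤ ∑ v with s'.reg 3 ≤ pos v, (8 * deg v + 17) + ∑ v ∈ S, (5 * deg v + 10))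
    (∑ v, (8 * deg v + 17) + ∑ v, (5 * deg v + 10)) ?_ ?_ ?_).mono ?_
  · refine ⟨hF, le_rfl, ∅, ∅, ?_, ?_, ?_, Nat.zero_le _⟩
    · constructor <;> simp
      intro v x _ _ hv
      exact absurd (hlt v) (by omega)
    · simp [Outputs, h1]
    · simp [h5, Covered]
  · rintro t s' ⟨-, -, S, F, -, -, -, ht⟩
    exact ht.trans (Nat.add_le_add (hsum _ _) (hsum _ _))
  · rintro t s₁ ⟨hF₁, h3, S, F, hI, hO, hcov, ht⟩ hb
    simp only [Test.holds, hF₁.zero] at hb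
    -- The body decrements first, so the vertex treated now has position `k`.
    obtain ⟨k, hk⟩ : ∃ k, s₁.reg 3 = k + 1 := ⟨s₁.reg 3 - 1, by omega⟩
    obtain ⟨v, hv⟩ := hpos k (by omega)
    have hq : Q k = v := by rw [← hv, hQ]
    rw [hk] at hI ht
    have hfilter : (Finset.univ.filter fun u => k ≤ pos u) =
        insert v (Finset.univ.filter fun u => k + 1 ≤ pos u) := by
      ext u
      simp only [Finset.mem_filter, Finset.mem_univ, true_and, Finset.mem_insert]
      constructor
      · intro hu
        rcases hu.eq_or_lt with hu | hu
        · exact Or.inl (hB.injective (hu.symm.trans hv.symm))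
        · exact Or.inr hu
      · rintro (rfl | hu)
        · exact hv.ge
        · exact (Nat.le_succ k).trans hu
    have htime : ∑ u with k ≤ pos u, (8 * deg u + 17) =
        8 * deg v + 17 + ∑ u with k + 1 ≤ pos u, (8 * deg u + 17) := by
      rw [hfilter, Finset.sum_insert]
      simp [hv]
    refine .seq (.block (.ifElse ?_ ?_))
    · intro hz
      simp [hF₁.queue, hF₁.zero, hk, hq] at hz
      refine .seq (.block (.seq ((findUncovered_spec hE (v := v) (w := p v)
        (by simpa using hF₁.nb) (by simpa using hF₁.zero) (by simp [hF₁.off, hF₁.queue, hk, hq])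
        (by simp [hF₁.off, hF₁.queue, hk, hq, hE.off_succ])
        (by simp [hF₁.par, hF₁.queue, hk, hq, hpar]) (by simp)).mono ?_)))
      rintro t₂ s₂ ⟨ht₂, ha, hr1, hr3, hr10, hr11, hflag⟩
      simp [hk] at ha hr1 hr3 hflag
      have hF₂ : SelectionFrame off nb par Q s₂ :=
        ⟨hr10, by rw [ha, hF₁.off], by rw [ha, hF₁.nb], by rw [ha, hF₁.par],
          by rw [ha, hF₁.queue]⟩
      refine .ifElse ?_ ?_
      · intro hf
        simp [hr10] at hf
        refine .skip ⟨hF₂, by omega, S, F, ?_, hO.congr hr1 (by rw [ha]), by rwa [ha], ?_⟩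
        -- With the flag unset, every unmarked neighbour of `v` is `p v`, so each other neighbour is
        -- covered.
        · rw [hr3]
          refine hI.step_of_covered hB hv fun x hvx hx => Or.inr ?_
          by_contra hc
          exact hx (hflag.1 hf x hvx ((hcov x).2 hc))
        · rw [hr3, htime]
          simp only [List.length_cons, List.length_nil]
          omega
      · intro hf
        simp only [Test.holds, hr10, hflag] at hf
        push Not at hf
        obtain ⟨x, hvx, hx0, hx⟩ := hf
        obtain ⟨hpS, hI'⟩ := hI.step_of_not_covered hB hG hv hvx hx ((hcov v).1 hz)
          ((hcov x).1 hx0)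
        refine (selectVertex_spec hE hF₂ hr11).mono ?_
        rintro t₃ s₃ ⟨ht₃, hF₃, hr1', hr3', ha2, hcov₃⟩
        refine ⟨hF₃, by omega, _, _, by rw [hr3', hr3]; exact hI',
          (hO.congr hr1 (by rw [ha])).insert hpS hr1' ha2, fun y => ?_, ?_⟩
        · rw [hcov₃ y, covered_insert, ha, hcov y]
          tauto
        · rw [hr3', hr3, htime, Finset.sum_insert hpS]
          simp only [List.length_cons, List.length_nil]
          omega
    · intro hz
      simp [hF₁.queue, hF₁.zero, hk, hq] at hz
      have hc : Covered G S v := by_contra fun hc => hz ((hcov v).2 hc)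
      refine .skip ⟨⟨by simpa using hF₁.zero, by simpa using hF₁.off, by simpa using hF₁.nb,
        by simpa using hF₁.par, by simpa using hF₁.queue⟩, by simp; omega, S, F, ?_,
        hO.congr (by simp) (by simp), by simpa using hcov, ?_⟩
      · simpa [hk] using hI.step_of_covered hB hv fun _ _ _ => Or.inl hc
      · simp only [List.foldl, Instr.exec, hk, Nat.add_sub_cancel, List.length_cons,
          List.length_nil, State.reg_setReg]
        simp only [Nat.reduceEqDiff, if_true, if_false, htime]
        omega
  · rintro t s' ⟨t', rfl, ⟨hF', h3, S, F, hI, hO, hcov, ht⟩, hb⟩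
    simp only [Test.holds, hF'.zero] at hb
    rw [show s'.reg 3 = 0 by omega] at hI
    exact ⟨Nat.succ_le_succ (ht.trans (Nat.add_le_add (hsum _ _) (hsum _ _))), S, hO,
      hI.isMinimumVEDominatingSet hB⟩

end

end VEDom

theorem mainTheorem1 :
    ∃ (p : VEDom.Program) (C : ℕ),
      ∀ (n : ℕ) (G : SimpleGraph (Fin n)), VEDom.IsBlockGraph G →
        ∀ adj : Fin n → List (Fin n), VEDom.IsAdjacencyList G adj →
          ∃ (t : ℕ) (s : VEDom.State) (S : Finset (Fin n)),
            VEDom.Run p (VEDom.inputState adj) t s ∧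
            t ≤ C * (n + G.edgeSet.ncard + 1) ∧
            VEDom.Outputs s S ∧
            VEDom.IsMinimumVEDominatingSet G S := by
  -- With degree sum `2m` the two phases take at most `46m + 48n + 2` steps.
  refine ⟨.seq VEDom.breadthFirstSearch VEDom.greedySelection, 50, fun n G hG adj hadj => ?_⟩
  have hE := VEDom.encodes_inputState hadj
  suffices H : VEDom.HaltsWith (.seq VEDom.breadthFirstSearch VEDom.greedySelection)
      (VEDom.inputState adj) fun t s => t ≤ 50 * (n + G.edgeSet.ncard + 1) ∧
        ∃ S, VEDom.Outputs s S ∧ VEDom.IsMinimumVEDominatingSet G S by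
    obtain ⟨t, s, hr, ht, S, hS⟩ := H
    exact ⟨t, s, S, hr, ht, hS⟩
  refine .seq ((VEDom.breadthFirstSearch_spec hE ⟨rfl, rfl, rfl, rfl, rfl, fun _ => rfl⟩ rfl rfl
    rfl fun _ => rfl).mono ?_)
  rintro t₁ s₁ ⟨hF, ht₁, done, vis, pos, p, hS, hvis⟩
  refine (VEDom.greedySelection_spec hE hG (hS.isBreadthFirst hvis)
    ⟨hF.zero, hF.off, hF.nb, rfl, rfl⟩ (fun v => hS.par_eq v (hvis v))
    (fun v => hS.queue_pos v (hvis v)) (fun v => hS.pos_lt v (hvis v))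
    (fun j hj => (hS.exists_pos j hj).imp fun _ h => h.2) hF.count hF.uncovered).mono ?_
  rintro t₂ s₂ ⟨ht₂, hS₂⟩
  refine ⟨?_, hS₂⟩
  have hm := VEDom.sum_length_adj hadj
  simp only [Finset.sum_add_distrib, ← Finset.mul_sum, hm, Finset.sum_const, Finset.card_univ,
    Fintype.card_fin, smul_eq_mul] at ht₁ ht₂
  omega
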